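/- For a group $G$ and a set $A$, let $\mathrm{CA}(G;A)$ be the monoid, under composition, of all cellular automata over $G$ and $A$, i.e. of all maps $\tau : A^G \to A^G$ for which there are a finite set $S \subseteq G$ and a function $\mu : A^S \to A$ with $\tau(x)(g) = \mu\big((x(sg))_{s \in S}\big)$ for all $x \in A^G$, $g \in G$. For a finite monoid $M$, let $\mathrm{Rank}(M)$ be the minimum cardinality of a subset of $M$ that generates $M$ as a monoid. The group $G$ acts on $A^G$ by $(x\cdot g)(h) = x(hg^{-1})$; let $G_x$ be the stabiliser of $x \in A^G$. For a subgroup $H \leq G$ with conjugacy class $[H]$, let $\alpha_{[H]}(G;A)$ be the number of $G$-orbits on $A^G$ that are contained in $\{x \in A^G : G_x \in [H]\}$. Let $\mathcal{E}_G$ be the set of pairs $([H],[K])$ of conjugacy classes of subgroups of $G$ such that $H \leq g^{-1}Kg$ for some $g \in G$ (pairs with $[H]=[K]$ included). Let $\delta$ be Kronecker's delta. Let $G$ be a finite abelian group with $\mathrm{Rank}(G) = m$, and let $A$ be a finite set of size $q \geq 2$. Let $H_1, H_2, \dots, H_r$ be the list of the different subgroups of $G$, with $H_1 = G$, and let $\alpha_i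 := \alpha_{[H_i]}(G;A)$. Then \[ \mathrm{Rank}(\mathrm{CA}(G;A)) \leq \sum_{i=2}^r m\alpha_i + 2r + |\mathcal{E}_G| - \delta(q,2) - \sum_{i=2}^r \big(3\delta(\alpha_i,1) + \delta(\alpha_i,2)\big) \leq \sum_{i=2}^r m\alpha_i + 2r + r^2 . \] -/

import Mathlib

namespace FiniteCA

/-- A cellular automaton over `G` and `A`: there are a finite memory set `S ⊆ G` and a local
function `μ : A^S → A` such that the value of `τ x` at `g` is `μ` applied to the restriction
to `S` of the configuration `h ↦ x (h * g)`. -/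
def IsCellularAutomaton {G A : Type*} [Group G] (τ : (G → A) → (G → A)) : Prop :=
  ∃ (S : Finset G) (μ : (S → A) → A), ∀ (x : G → A) (g : G), τ x g = μ (fun s => x (s * g))

theorem isCellularAutomaton_id {G A : Type*} [Group G] :
    IsCellularAutomaton (id : (G → A) → (G → A)) :=
  ⟨{1}, fun y => y ⟨1, by simp⟩, fun x g => by simp⟩

theorem IsCellularAutomaton.comp {G A : Type*} [Group G] {τ σ : (G → A) → (G → A)}
    (hτ : IsCellularAutomaton τ) (hσ : IsCellularAutomaton σ) : IsCellularAutomaton (τ ∘ σ) := by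
  classical
  obtain ⟨T, μ, hμ⟩ := hτ
  obtain ⟨S, ν, hν⟩ := hσ
  refine ⟨Finset.image₂ (fun s t => s * t) S T,
    fun y => μ (fun t => ν (fun s =>
      y ⟨s.1 * t.1, Finset.mem_image₂_of_mem s.2 t.2⟩)), fun x g => ?_⟩
  simp only [Function.comp_apply, hμ, hν, mul_assoc]

/-- The monoid `CA(G; A)` of all cellular automata over `G` and `A`, under composition, as a
submonoid of the monoid of all transformations of `A^G`. -/
def CA (G A : Type*) [Group G] : Submonoid (Function.End (G → A)) where
  carrier := {τ | IsCellularAutomaton (G := G) (A := A) τ}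
  one_mem' := isCellularAutomaton_id
  mul_mem' := fun hτ hσ => IsCellularAutomaton.comp hτ hσ

/-- The rank of a finite monoid: the minimum cardinality of a subset generating it as a monoid. -/
noncomputable def rank (M : Type*) [Monoid M] : ℕ :=
  sInf {n | ∃ T : Finset M, T.card = n ∧ Submonoid.closure (T : Set M) = ⊤}

/-- On a finite monoid the infimum defining the rank is attained. -/
theorem exists_card_eq_rank (M : Type*) [Monoid M] [Finite M] :
    ∃ T : Finset M, T.card = rank M ∧ Submonoid.closure (T : Set M) = ⊤ := by
  have := Fintype.ofFinite M
  exact Nat.sInf_mem (s := {n | ∃ T : Finset M, T.card = n ∧ Submonoid.closure (T : Set M) = ⊤})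
    ⟨_, Finset.univ, rfl, by simp⟩

/-- The right action of `G` on configurations: `(x · g)(h) = x (h * g⁻¹)`. -/
def shift {G A : Type*} [Group G] (x : G → A) (g : G) : G → A := fun h => x (h * g⁻¹)

theorem shift_one {G A : Type*} [Group G] (x : G → A) : shift x 1 = x := by
  funext h; simp [shift]

theorem shift_mul {G A : Type*} [Group G] (x : G → A) (a b : G) :
    shift x (a * b) = shift (shift x a) b := by
  funext h; simp [shift, mul_assoc]

/-- The orbit `xG` of a configuration. -/
def orbit {G A : Type*} [Group G] (x : G → A) : Set (G → A) := Set.range (shift x)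

/-- The set of all `G`-orbits on `A^G`. -/
def orbits (G A : Type*) [Group G] : Set (Set (G → A)) := Set.range orbit

/-- The stabiliser `G_x` of a configuration. -/
def stabiliser {G A : Type*} [Group G] (x : G → A) : Subgroup G where
  carrier := {g | shift x g = x}
  one_mem' := shift_one x
  mul_mem' := fun {a b} (ha : shift x a = x) (hb : shift x b = x) =>
    show shift x (a * b) = x by rw [shift_mul, ha, hb]
  inv_mem' := fun {a} (ha : shift x a = x) => show shift x a⁻¹ = x by
    conv_lhs => rw [← ha]
    rw [← shift_mul, mul_inv_cancel, shift_one]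

/-- The conjugate subgroup `g⁻¹ H g`. -/
def conjugate {G : Type*} [Group G] (H : Subgroup G) (g : G) : Subgroup G :=
  H.map (MulAut.conj g⁻¹).toMonoidHom

/-- The conjugacy class `[H]` of a subgroup. -/
def conjClass {G : Type*} [Group G] (H : Subgroup G) : Set (Subgroup G) :=
  Set.range (conjugate H)

/-- The set of configurations whose stabiliser lies in the conjugacy class `c`. -/
def block {G : Type*} (A : Type*) [Group G] (c : Set (Subgroup G)) : Set (G → A) :=
  {x | stabiliser x ∈ c}

/-- The number of `G`-orbits on `A^G` contained in the block of the conjugacy class `c`. -/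
noncomputable def alpha {G : Type*} (A : Type*) [Group G] (c : Set (Subgroup G)) : ℕ :=
  {O ∈ orbits G A | O ⊆ block A c}.ncard

/-- The edge set of the directed graph on conjugacy classes of subgroups: the pairs
`([H], [K])`, loops included, such that `H ≤ g⁻¹ K g` for some `g`. -/
def edges (G : Type*) [Group G] : Set (Set (Subgroup G) × Set (Subgroup G)) :=
  {p | ∃ H K : Subgroup G, p = (conjClass H, conjClass K) ∧ ∃ g : G, H ≤ conjugate K g}

/-- Kronecker's delta. -/
def delta (a b : ℕ) : ℤ := if a = b then 1 else 0

end FiniteCA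

/-!
Cellular automata over a finite group `G` are the equivariant self-maps of the `G`-set `A^G`, and an
equivariant self-map `τ` of any finite `G`-set `X` factors into elementary ones. If `τ` is bijective
and moves `x`, following it by the exchange of the orbits of `τ x` and `x` creates a new orbit of
fixed points. If `x` is not in the image of `τ`, then `τ` is the map that freezes the orbit of `x`
and agrees with `τ` elsewhere, followed by the collapsing `x ↦ τ x` of one orbit onto another.

Conjugating an elementary map by an automorphism `σ` applies `σ` to its two points. So, when all
subgroups are normal, one collapsing suffices for each pair of subgroups `H ≤ K` (none for `H = K`
if `H` has a single orbit), and the automorphisms are generated by two permutations of the orbits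
with stabiliser `H` for each `H` (one if there are two orbits, none if there is one) together with
the rotations of the single orbits, which need `Rank(G)` generators per orbit and none on fixed
points.
-/

open MulAction
open FiniteCA (delta)

theorem exists_closure_pair_perm_eq_top (α : Type*) [Finite α] [Nontrivial α] :
    ∃ σ π : Equiv.Perm α, Submonoid.closure {σ, π} = ⊤ := by
  classical
  have := Fintype.ofFinite α
  obtain ⟨σ, hσ, -⟩ := (Finset.univ : Finset α).exists_cycleOn
  have hne : ∀ x, σ x ≠ x := fun x =>
    hσ.apply_ne (by simpa using Set.nontrivial_univ) (Finset.mem_coe.mpr (Finset.mem_univ x))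
  have hsupp : σ.support = Finset.univ := by ext x; simp [hne x]
  have hcycle : σ.IsCycle := Equiv.Perm.isCycle_iff_exists_isCycleOn.mpr
    ⟨Set.univ, Set.nontrivial_univ, by simpa using hσ, fun _ _ => Set.mem_univ _⟩
  have x : α := Classical.arbitrary α
  refine ⟨σ, Equiv.swap x (σ x), ?_⟩
  rw [← Subgroup.closure_toSubmonoid_of_finite,
    Equiv.Perm.closure_cycle_adjacent_swap hcycle hsupp x, Subgroup.top_toSubmonoid]

theorem exists_closure_perm_eq_top (α : Type*) [Finite α] :
    ∃ T : Finset (Equiv.Perm α), Submonoid.closure (T : Set (Equiv.Perm α)) = ⊤ ∧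
      (T.card : ℤ) ≤ 2 - delta (Nat.card α) 2 - 2 * delta (Nat.card α) 1 := by
  classical
  have := Fintype.ofFinite α
  rcases subsingleton_or_nontrivial α with hα | hα
  · refine ⟨∅, Subsingleton.elim _ _, ?_⟩
    have : Nat.card α ≤ 1 := Finite.card_le_one_iff_subsingleton.mpr hα
    interval_cases Nat.card α <;> simp [delta]
  have hcard : Nat.card α ≠ 1 := Finite.one_lt_card.ne'
  obtain ⟨σ, π, hσπ⟩ := exists_closure_pair_perm_eq_top α
  by_cases htwo : Nat.card α = 2
  · refine ⟨Finset.univ.erase 1, ?_, ?_⟩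
    · rw [Finset.coe_erase, Finset.coe_univ, ← Submonoid.closure_insert_one,
        Set.insert_sdiff_singleton, Set.insert_eq_of_mem (Set.mem_univ 1), Submonoid.closure_univ]
    · rw [Finset.card_erase_of_mem (Finset.mem_univ 1), Finset.card_univ, Fintype.card_perm,
        ← Nat.card_eq_fintype_card, htwo]
      decide
  · refine ⟨{σ, π}, by simpa using hσπ, ?_⟩
    rw [delta, delta, if_neg htwo, if_neg hcard]
    have : ({σ, π} : Finset (Equiv.Perm α)).card ≤ 2 := Finset.card_le_two
    lia

/-- The monoid of `G`-equivariant self-maps of a `G`-set. -/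
def equivariantEnd (G X : Type*) [Group G] [MulAction G X] : Submonoid (Function.End X) where
  carrier := {τ | ∀ (g : G) (x : X), τ (g • x) = g • τ x}
  one_mem' := fun _ _ => rfl
  mul_mem' := fun {σ τ} hσ hτ g x => by
    change σ (τ (g • x)) = g • σ (τ x)
    rw [hτ, hσ]

namespace equivariantEnd

section Elementary

variable {G X : Type*} [Group G] [MulAction G X] {τ : Function.End X} {x y z : X}

theorem stabilizer_le_stabilizer_apply (hτ : τ ∈ equivariantEnd G X) (x : X) :
    stabilizer G x ≤ stabilizer G (τ x) := fun g hg => by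
  rw [mem_stabilizer_iff] at *
  rw [← hτ, hg]

theorem stabilizer_apply_of_injective (hτ : τ ∈ equivariantEnd G X) (hinj : Function.Injective τ)
    (x : X) : stabilizer G (τ x) = stabilizer G x := by
  ext g
  rw [mem_stabilizer_iff, mem_stabilizer_iff, ← hτ, hinj.eq_iff]

theorem apply_mem_orbit_apply_iff (hτ : τ ∈ equivariantEnd G X) (hinj : Function.Injective τ) :
    τ y ∈ orbit G (τ x) ↔ y ∈ orbit G x := by
  simp only [mem_orbit_iff, ← hτ _ x, hinj.eq_iff]

theorem smul_eq_smul_of_stabilizer_le (h : stabilizer G x ≤ stabilizer G y) {g k : G}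
    (hgk : g • x = k • x) : g • y = k • y := by
  have : k⁻¹ * g ∈ stabilizer G x := by rw [mem_stabilizer_iff, mul_smul, hgk, inv_smul_smul]
  simpa only [mem_stabilizer_iff, mul_smul, inv_smul_eq_iff] using h this

theorem stabilizer_smul_of_normal (hx : (stabilizer G x).Normal) (g : G) :
    stabilizer G (g • x) = stabilizer G x := by
  rw [stabilizer_smul_eq_stabilizer_map_conj]
  exact hx.conj_smul_eq_self g

theorem smul_mem_orbit_iff {g : G} : g • z ∈ orbit G x ↔ z ∈ orbit G x := by
  rw [← orbit_eq_iff, orbit_smul, orbit_eq_iff]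

theorem mem_of_mul_eq_mul_of_injective [Finite X] {N : Submonoid (Function.End X)}
    {σ σ' : Function.End X} (hτN : τ ∈ N) (hinj : Function.Injective τ)
    (hσN : σ ∈ N) (h : τ * σ = σ' * τ) : σ' ∈ N := by
  let e : Equiv.Perm X := Equiv.ofBijective τ (Finite.injective_iff_bijective.mp hinj)
  obtain ⟨n, hn, hen⟩ := (isOfFinOrder_of_finite e).exists_pow_eq_one
  have hτn : τ ^ n = 1 := by
    have : toEndHom (M := Equiv.Perm X) (α := X) (e ^ n) = 1 := by rw [hen, map_one]
    rwa [map_pow] at this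
  have hσ' : σ' = τ * σ * τ ^ (n - 1) := by
    rw [h, mul_assoc, mul_pow_sub_one hn.ne', hτn, mul_one]
  exact hσ' ▸ mul_mem (mul_mem hτN hσN) (pow_mem hτN _)

open Classical in
/-- The elementary collapsing `g • x ↦ g • y` of the orbit of `x` onto the orbit of `y`, which fixes
every other point. It depends on choices unless `stabilizer G x ≤ stabilizer G y`. -/
noncomputable def collapse (G : Type*) {X : Type*} [Group G] [MulAction G X] (x y : X) :
    Function.End X := fun z =>
  if h : ∃ g : G, g • x = z then h.choose • y else z

theorem collapse_smul (h : stabilizer G x ≤ stabilizer G y) (g : G) :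
    collapse G x y (g • x) = g • y := by
  have hg : ∃ k : G, k • x = g • x := ⟨g, rfl⟩
  exact (dif_pos hg).trans (smul_eq_smul_of_stabilizer_le h hg.choose_spec)

theorem collapse_of_notMem (hz : z ∉ orbit G x) : collapse G x y z = z := dif_neg hz

theorem collapse_mem (h : stabilizer G x ≤ stabilizer G y) :
    collapse G x y ∈ equivariantEnd G X := fun g z => by
  by_cases hz : z ∈ orbit G x
  · obtain ⟨k, rfl⟩ := hz
    simp only [smul_smul, collapse_smul h]
  · rw [collapse_of_notMem hz, collapse_of_notMem (by rwa [smul_mem_orbit_iff])]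

theorem mul_collapse (hτ : τ ∈ equivariantEnd G X) (hinj : Function.Injective τ)
    (h : stabilizer G x ≤ stabilizer G y) :
    τ * collapse G x y = collapse G (τ x) (τ y) * τ := by
  have h' : stabilizer G (τ x) ≤ stabilizer G (τ y) := by
    rwa [stabilizer_apply_of_injective hτ hinj, stabilizer_apply_of_injective hτ hinj]
  funext z
  change τ (collapse G x y z) = collapse G (τ x) (τ y) (τ z)
  by_cases hz : z ∈ orbit G x
  · obtain ⟨g, rfl⟩ := hz
    simp only [collapse_smul h, hτ g, collapse_smul h']
  · rw [collapse_of_notMem hz, collapse_of_notMem (mt (apply_mem_orbit_apply_iff hτ hinj).mp hz)]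

open Classical in
/-- The automorphism exchanging the orbits of `x` and `y` by `g • x ↔ g • y`; when `y` lies in the
orbit of `x`, it is the rotation `g • x ↦ g • y` of that orbit. All other points are fixed. -/
noncomputable def exchange (G : Type*) {X : Type*} [Group G] [MulAction G X] (x y : X) :
    Function.End X :=
  fun z => if z ∈ orbit G x then collapse G x y z else collapse G y x z

theorem exchange_of_mem_left (hz : z ∈ orbit G x) : exchange G x y z = collapse G x y z :=
  if_pos hz

theorem exchange_of_notMem_left (hz : z ∉ orbit G x) : exchange G x y z = collapse G y x z :=
  if_neg hz

theorem exchange_smul_left (h : stabilizer G x = stabilizer G y) (g : G) :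
    exchange G x y (g • x) = g • y := by
  rw [exchange_of_mem_left (mem_orbit x g), collapse_smul h.le]

theorem exchange_left (h : stabilizer G x = stabilizer G y) : exchange G x y x = y := by
  simpa using exchange_smul_left h 1

theorem exchange_smul_right (h : stabilizer G x = stabilizer G y) (hxy : y ∉ orbit G x) (g : G) :
    exchange G x y (g • y) = g • x := by
  rw [exchange_of_notMem_left (by rwa [smul_mem_orbit_iff]), collapse_smul h.ge]

theorem exchange_of_notMem (hx : z ∉ orbit G x) (hy : z ∉ orbit G y) : exchange G x y z = z := by
  rw [exchange_of_notMem_left hx, collapse_of_notMem hy]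

theorem exchange_mem (h : stabilizer G x = stabilizer G y) :
    exchange G x y ∈ equivariantEnd G X := fun g z => by
  by_cases hz : z ∈ orbit G x
  · have hgz : g • z ∈ orbit G x := by rwa [smul_mem_orbit_iff]
    rw [exchange_of_mem_left hz, exchange_of_mem_left hgz, collapse_mem h.le]
  · have hgz : g • z ∉ orbit G x := by rwa [smul_mem_orbit_iff]
    rw [exchange_of_notMem_left hz, exchange_of_notMem_left hgz, collapse_mem h.ge]

theorem exchange_mul_exchange (h : stabilizer G x = stabilizer G y) :
    exchange G x y * exchange G y x = 1 := by
  funext z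
  change exchange G x y (exchange G y x z) = z
  by_cases hy : z ∈ orbit G y
  · obtain ⟨g, rfl⟩ := hy
    simp only [exchange_smul_left h.symm, exchange_smul_left h]
  by_cases hx : z ∈ orbit G x
  · obtain ⟨g, rfl⟩ := hx
    rw [smul_mem_orbit_iff] at hy
    have hxy : y ∉ orbit G x := mt mem_orbit_symm.mp hy
    simp only [exchange_smul_right h.symm hy, exchange_smul_right h hxy]
  · rw [exchange_of_notMem hy hx, exchange_of_notMem hx hy]

theorem exchange_injective (h : stabilizer G x = stabilizer G y) :
    Function.Injective (exchange G x y) :=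
  Function.LeftInverse.injective (g := exchange G y x) (congrFun (exchange_mul_exchange h.symm))

theorem mul_exchange (hτ : τ ∈ equivariantEnd G X) (hinj : Function.Injective τ)
    (h : stabilizer G x = stabilizer G y) :
    τ * exchange G x y = exchange G (τ x) (τ y) * τ := by
  funext z
  change τ (exchange G x y z) = exchange G (τ x) (τ y) (τ z)
  by_cases hz : z ∈ orbit G x
  · have hτz := (apply_mem_orbit_apply_iff hτ hinj).mpr hz
    rw [exchange_of_mem_left hz, exchange_of_mem_left hτz]
    exact congrFun (mul_collapse hτ hinj h.le) z
  · have hτz := mt (apply_mem_orbit_apply_iff hτ hinj).mp hz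
    rw [exchange_of_notMem_left hz, exchange_of_notMem_left hτz]
    exact congrFun (mul_collapse hτ hinj h.ge) z

theorem exchange_smul_smul (h : stabilizer G x = stabilizer G y) (g : G) :
    exchange G (g • x) (g • y) = exchange G x y := by
  have hg : stabilizer G (g • x) = stabilizer G (g • y) := by
    simp only [stabilizer_smul_eq_stabilizer_map_conj, h]
  funext z
  by_cases hx : z ∈ orbit G x
  · obtain ⟨k, rfl⟩ := hx
    simpa [mul_smul, exchange_smul_left h] using exchange_smul_left hg (k * g⁻¹)
  by_cases hy : z ∈ orbit G y
  · obtain ⟨k, rfl⟩ := hy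
    have hxy : y ∉ orbit G x := by rwa [smul_mem_orbit_iff] at hx
    simpa [mul_smul, exchange_smul_right h hxy] using
      exchange_smul_right hg (by rwa [orbit_smul, smul_mem_orbit_iff]) (k * g⁻¹)
  · rw [exchange_of_notMem hx hy, exchange_of_notMem] <;> rwa [orbit_smul]

theorem exchange_smul_mul_exchange_smul (hx : (stabilizer G x).Normal) (g k : G) :
    exchange G x (g • x) * exchange G x (k • x) = exchange G x ((k * g) • x) := by
  have h : ∀ g : G, stabilizer G x = stabilizer G (g • x) := fun g =>
    (stabilizer_smul_of_normal hx g).symm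
  funext z
  change exchange G x (g • x) (exchange G x (k • x) z) = exchange G x ((k * g) • x) z
  by_cases hz : z ∈ orbit G x
  · obtain ⟨l, rfl⟩ := hz
    simp only [exchange_smul_left (h _), smul_smul, mul_assoc]
  · simp only [exchange_of_notMem hz, orbit_smul, hz, not_false_eq_true]

theorem exchange_self_right (x : X) : exchange G x x = 1 := by
  funext z
  by_cases hz : z ∈ orbit G x
  · obtain ⟨g, rfl⟩ := hz
    exact exchange_smul_left rfl g
  · exact exchange_of_notMem hz hz

theorem fixedPoints_ssubset_of_injective (hτ : τ ∈ equivariantEnd G X)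
    (hinj : Function.Injective τ) (hx : τ x ≠ x) :
    Function.fixedPoints τ ⊂ Function.fixedPoints (exchange G (τ x) x * τ) := by
  have hstab := stabilizer_apply_of_injective hτ hinj x
  have hfix : exchange G (τ x) x (τ x) = x := exchange_left hstab
  refine (Set.ssubset_iff_of_subset fun z hz => ?_).mpr ⟨x, hfix, hx⟩
  have hz : τ z = z := hz
  have hzx : z ∉ orbit G x := by
    rintro ⟨g, rfl⟩
    exact hx (smul_left_cancel g ((hτ g x).symm.trans hz))
  have hzτx : z ∉ orbit G (τ x) := by
    rwa [← hz, apply_mem_orbit_apply_iff hτ hinj]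
  change exchange G (τ x) x (τ z) = z
  rw [hz, exchange_of_notMem hzτx hzx]

theorem apply_notMem_orbit_of_notMem_range (hτ : τ ∈ equivariantEnd G X)
    (hx : x ∉ Set.range τ) (y : X) : τ y ∉ orbit G x := by
  rintro ⟨g, hg⟩
  exact hx ⟨g⁻¹ • y, by rw [hτ, ← hg, inv_smul_smul]⟩

open Classical in
/-- The map fixing the orbit of `x` pointwise and agreeing with `τ` elsewhere. -/
noncomputable def freezeOrbit (G : Type*) {X : Type*} [Group G] [MulAction G X] (x : X)
    (τ : Function.End X) : Function.End X := fun z =>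
  if z ∈ orbit G x then z else τ z

theorem freezeOrbit_of_mem (hz : z ∈ orbit G x) : freezeOrbit G x τ z = z := if_pos hz

theorem freezeOrbit_of_notMem (hz : z ∉ orbit G x) : freezeOrbit G x τ z = τ z := if_neg hz

theorem freezeOrbit_mem (hτ : τ ∈ equivariantEnd G X) (x : X) :
    freezeOrbit G x τ ∈ equivariantEnd G X := fun g z => by
  by_cases hz : z ∈ orbit G x
  · rw [freezeOrbit_of_mem hz, freezeOrbit_of_mem (smul_mem_orbit_iff.mpr hz)]
  · rw [freezeOrbit_of_notMem hz, freezeOrbit_of_notMem (mt smul_mem_orbit_iff.mp hz), hτ]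

theorem collapse_mul_freezeOrbit (hτ : τ ∈ equivariantEnd G X) (hx : x ∉ Set.range τ) :
    collapse G x (τ x) * freezeOrbit G x τ = τ := by
  funext z
  change collapse G x (τ x) (freezeOrbit G x τ z) = τ z
  by_cases hz : z ∈ orbit G x
  · rw [freezeOrbit_of_mem hz]
    obtain ⟨g, rfl⟩ := hz
    simp only [collapse_smul (stabilizer_le_stabilizer_apply hτ x), hτ g]
  · rw [freezeOrbit_of_notMem hz,
      collapse_of_notMem (apply_notMem_orbit_of_notMem_range hτ hx z)]

theorem fixedPoints_ssubset_of_notMem_range (hx : x ∉ Set.range τ) :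
    Function.fixedPoints τ ⊂ Function.fixedPoints (freezeOrbit G x τ) := by
  refine (Set.ssubset_iff_of_subset fun z hz => ?_).mpr
    ⟨x, freezeOrbit_of_mem (mem_orbit_self x), fun h => hx ⟨x, h⟩⟩
  by_cases hzx : z ∈ orbit G x
  · exact freezeOrbit_of_mem hzx
  · exact (freezeOrbit_of_notMem hzx).trans hz

theorem equivariantEnd_le_of_exchange_mem_of_collapse_mem [Finite X]
    {N : Submonoid (Function.End X)}
    (hexchange : ∀ x y, stabilizer G x = stabilizer G y → exchange G x y ∈ N)
    (hcollapse : ∀ x y, stabilizer G x ≤ stabilizer G y → y ∉ orbit G x → collapse G x y ∈ N) :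
    equivariantEnd G X ≤ N := by
  classical
  intro τ hτ
  induction hF : Function.fixedPoints τ using WellFoundedGT.induction generalizing τ with
  | _ F ih =>
  subst hF
  by_cases hsurj : Function.Surjective τ
  · have hinj : Function.Injective τ := Finite.injective_iff_surjective.mpr hsurj
    by_cases hfix : ∀ x, τ x = x
    · exact (funext hfix : τ = 1) ▸ one_mem N
    obtain ⟨x, hx⟩ := not_forall.mp hfix
    have hstab := stabilizer_apply_of_injective hτ hinj x
    have hfactor : τ = exchange G x (τ x) * (exchange G (τ x) x * τ) := by
      rw [← mul_assoc, exchange_mul_exchange hstab.symm, one_mul]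
    rw [hfactor]
    exact mul_mem (hexchange _ _ hstab.symm)
      (ih _ (fixedPoints_ssubset_of_injective hτ hinj hx) (mul_mem (exchange_mem hstab) hτ) rfl)
  · obtain ⟨x, hx⟩ := not_forall.mp hsurj
    rw [← collapse_mul_freezeOrbit hτ hx]
    exact mul_mem
      (hcollapse _ _ (stabilizer_le_stabilizer_apply hτ x)
        (apply_notMem_orbit_of_notMem_range hτ hx x))
      (ih _ (fixedPoints_ssubset_of_notMem_range hx) (freezeOrbit_mem hτ x) rfl)

theorem collapse_mem_of_stabilizer_eq [Finite X] {N : Submonoid (Function.End X)}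
    (hexchange : ∀ x y, stabilizer G x = stabilizer G y → exchange G x y ∈ N) {x' y' : X}
    (hx : stabilizer G x = stabilizer G x') (hy : stabilizer G y = stabilizer G y')
    (hxy : y ∉ orbit G x) (hxy' : y' ∉ orbit G x') (hle : stabilizer G x ≤ stabilizer G y)
    (h : collapse G x y ∈ N) : collapse G x' y' ∈ N := by
  set σ := exchange G x x'
  have hσ : σ ∈ equivariantEnd G X := exchange_mem hx
  have hσinj : Function.Injective σ := exchange_injective hx
  have hσx : σ x = x' := exchange_left hx
  have hσy : stabilizer G (σ y) = stabilizer G y' :=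
    (stabilizer_apply_of_injective hσ hσinj y).trans hy
  have hσmul := mul_collapse hσ hσinj hle
  rw [hσx] at hσmul
  have hσN : collapse G x' (σ y) ∈ N :=
    mem_of_mul_eq_mul_of_injective (hexchange _ _ hx) hσinj h hσmul
  have hx'σy : x' ∉ orbit G (σ y) := by
    rwa [← hσx, apply_mem_orbit_apply_iff hσ hσinj, mem_orbit_symm]
  have hfix : exchange G (σ y) y' x' = x' :=
    exchange_of_notMem hx'σy (mt mem_orbit_symm.mp hxy')
  have hle' : stabilizer G x' ≤ stabilizer G (σ y) := by rwa [← hx, hσy, ← hy]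
  have hmul := mul_collapse (exchange_mem hσy) (exchange_injective hσy) hle'
  rw [hfix, exchange_left hσy] at hmul
  exact mem_of_mul_eq_mul_of_injective (hexchange _ _ hσy) (exchange_injective hσy) hσN hmul

end Elementary

section Orbits

variable {G X : Type*} [Group G] [MulAction G X] {N : Submonoid (Function.End X)}

theorem exists_smul_out_eq (x : X) : ∃ g : G, g • (⟦x⟧ : orbitRel.Quotient G X).out = x :=
  mem_orbit_symm.mp (orbitRel_apply.mp (Quotient.mk_out (s := orbitRel G X) x))

theorem mk_smul_out_eq (g : G) (ω : orbitRel.Quotient G X) :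
    (⟦g • ω.out⟧ : orbitRel.Quotient G X) = ω :=
  (Quotient.sound (orbitRel_apply.mpr (mem_orbit ω.out g))).trans ω.out_eq

theorem out_mem_orbit_out_iff {ω ω' : orbitRel.Quotient G X} :
    ω.out ∈ orbit G ω'.out ↔ ω = ω' :=
  orbitRel_apply.symm.trans Quotient.out_equiv_out

/-- The map `g • ω.out ↦ g • (π ω).out` induced by a map `π` of orbits. It depends on choices unless
`π` does not shrink the stabilisers of the representatives. -/
noncomputable def moveOrbits (π : orbitRel.Quotient G X → orbitRel.Quotient G X) :
    Function.End X := fun x =>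
  (exists_smul_out_eq (G := G) x).choose • (π ⟦x⟧).out

theorem moveOrbits_smul_out {π : orbitRel.Quotient G X → orbitRel.Quotient G X}
    {ω : orbitRel.Quotient G X} (h : stabilizer G ω.out ≤ stabilizer G (π ω).out) (g : G) :
    moveOrbits π (g • ω.out) = g • (π ω).out := by
  have hg := (exists_smul_out_eq (G := G) (g • ω.out)).choose_spec
  unfold moveOrbits
  simp only [mk_smul_out_eq] at hg ⊢
  exact smul_eq_smul_of_stabilizer_le h hg

open Classical in
theorem stabilizer_out_ofSubtype {K : Subgroup G}
    (σ : Equiv.Perm {ω : orbitRel.Quotient G X // stabilizer G ω.out = K})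
    (ω : orbitRel.Quotient G X) :
    stabilizer G (Equiv.Perm.ofSubtype σ ω).out = stabilizer G ω.out := by
  by_cases hω : stabilizer G ω.out = K
  · rw [Equiv.Perm.ofSubtype_apply_of_mem σ hω, (σ ⟨ω, hω⟩).2, hω]
  · rw [Equiv.Perm.ofSubtype_apply_of_not_mem σ hω]

open Classical in
/-- The action on `X` of the permutations of the orbits with stabiliser `K`, transporting chosen
representatives to chosen representatives. -/
noncomputable def permuteOrbits (K : Subgroup G) :
    Equiv.Perm {ω : orbitRel.Quotient G X // stabilizer G ω.out = K} →* Function.End X where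
  toFun σ := moveOrbits (Equiv.Perm.ofSubtype σ)
  map_one' := by
    funext x
    obtain ⟨g, hg⟩ := exists_smul_out_eq (G := G) x
    rw [← hg, moveOrbits_smul_out (stabilizer_out_ofSubtype _ _).ge, map_one]
    rfl
  map_mul' σ σ' := by
    funext x
    obtain ⟨g, hg⟩ := exists_smul_out_eq (G := G) x
    change _ = moveOrbits _ (moveOrbits _ x)
    rw [← hg, moveOrbits_smul_out (stabilizer_out_ofSubtype _ _).ge,
      moveOrbits_smul_out (stabilizer_out_ofSubtype _ _).ge,
      moveOrbits_smul_out (stabilizer_out_ofSubtype _ _).ge, map_mul, Equiv.Perm.mul_apply]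

open Classical in
theorem permuteOrbits_smul_out {K : Subgroup G}
    (σ : Equiv.Perm {ω : orbitRel.Quotient G X // stabilizer G ω.out = K}) (g : G)
    (ω : orbitRel.Quotient G X) :
    permuteOrbits K σ (g • ω.out) = g • (Equiv.Perm.ofSubtype σ ω).out :=
  moveOrbits_smul_out (stabilizer_out_ofSubtype σ ω).ge g

theorem permuteOrbits_mem {K : Subgroup G}
    (σ : Equiv.Perm {ω : orbitRel.Quotient G X // stabilizer G ω.out = K}) :
    permuteOrbits K σ ∈ equivariantEnd G X := fun g x => by
  obtain ⟨k, hk⟩ := exists_smul_out_eq (G := G) x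
  rw [← hk, smul_smul, permuteOrbits_smul_out, permuteOrbits_smul_out, mul_smul]

open Classical in
theorem permuteOrbits_swap {K : Subgroup G}
    (ω ω' : {ω : orbitRel.Quotient G X // stabilizer G ω.out = K}) :
    permuteOrbits K (Equiv.swap ω ω') = exchange G ω.1.out ω'.1.out := by
  have h : stabilizer G ω.1.out = stabilizer G ω'.1.out := ω.2.trans ω'.2.symm
  funext x
  obtain ⟨g, hg⟩ := exists_smul_out_eq (G := G) x
  rw [← hg, permuteOrbits_smul_out, Equiv.Perm.ofSubtype_swap_eq]
  generalize (⟦x⟧ : orbitRel.Quotient G X) = ω''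
  by_cases hω : ω'' = ω
  · rw [hω, Equiv.swap_apply_left, exchange_smul_left h]
  have hωorbit : ω''.out ∉ orbit G ω.1.out := mt out_mem_orbit_out_iff.mp hω
  by_cases hω' : ω'' = ω'
  · subst hω'
    rw [Equiv.swap_apply_right, exchange_smul_right h hωorbit]
  · rw [Equiv.swap_apply_of_ne_of_ne hω hω', exchange_of_notMem]
    · rwa [smul_mem_orbit_iff]
    · rwa [smul_mem_orbit_iff, out_mem_orbit_out_iff]

theorem exchange_out_mem_of_closure_perm_eq_top {K : Subgroup G}
    {T : Set (Equiv.Perm {ω : orbitRel.Quotient G X // stabilizer G ω.out = K})}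
    (hT : Submonoid.closure T = ⊤) (h : ∀ σ ∈ T, permuteOrbits K σ ∈ N)
    (ω ω' : {ω : orbitRel.Quotient G X // stabilizer G ω.out = K}) :
    exchange G ω.1.out ω'.1.out ∈ N := by
  classical
  have hle : Submonoid.closure T ≤ N.comap (permuteOrbits K) := Submonoid.closure_le.mpr h
  rw [← permuteOrbits_swap]
  exact hle (hT ▸ Submonoid.mem_top _)

theorem exchange_smul_right_mem_of_closure_eq_top {T : Set G} (hT : Submonoid.closure T = ⊤)
    {x : X} (hx : (stabilizer G x).Normal) (h : ∀ t ∈ T, exchange G x (t • x) ∈ N) (g : G) :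
    exchange G x (g • x) ∈ N := by
  have hg : g ∈ Submonoid.closure T := hT ▸ Submonoid.mem_top g
  induction hg using Submonoid.closure_induction with
  | mem t ht => exact h t ht
  | one => rw [one_smul, exchange_self_right]; exact one_mem N
  | mul k l _ _ hk hl => rw [← exchange_smul_mul_exchange_smul hx]; exact mul_mem hl hk

theorem exchange_mem_of_exchange_out_mem [Finite X] (hnormal : ∀ x : X, (stabilizer G x).Normal)
    (hrotate : ∀ (ω : orbitRel.Quotient G X) (g : G), exchange G ω.out (g • ω.out) ∈ N)
    (hswap : ∀ ω ω' : orbitRel.Quotient G X, stabilizer G ω.out = stabilizer G ω'.out →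
      exchange G ω.out ω'.out ∈ N)
    {x y : X} (hxy : stabilizer G x = stabilizer G y) : exchange G x y ∈ N := by
  obtain ⟨g, hg⟩ := exists_smul_out_eq (G := G) x
  obtain ⟨h, hh⟩ := exists_smul_out_eq (G := G) y
  generalize (⟦x⟧ : orbitRel.Quotient G X) = ω at hg
  generalize (⟦y⟧ : orbitRel.Quotient G X) = ω' at hh
  obtain ⟨k, rfl⟩ : ∃ k, h = g * k := ⟨g⁻¹ * h, (mul_inv_cancel_left g h).symm⟩
  subst hg
  rw [mul_smul] at hh
  subst hh
  have hstab : stabilizer G ω.out = stabilizer G ω'.out := by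
    simpa only [stabilizer_smul_of_normal (hnormal _)] using hxy
  rw [exchange_smul_smul (by rw [hstab, stabilizer_smul_of_normal (hnormal _)])]
  by_cases hω : ω = ω'
  · exact hω ▸ hrotate ω k
  have hrot : stabilizer G ω'.out = stabilizer G (k • ω'.out) :=
    (stabilizer_smul_of_normal (hnormal _) k).symm
  have hout : ω.out ∉ orbit G ω'.out := mt out_mem_orbit_out_iff.mp hω
  have hmul := mul_exchange (exchange_mem hrot) (exchange_injective hrot) hstab
  rw [exchange_left hrot, exchange_of_notMem hout (by rwa [orbit_smul])] at hmul
  exact mem_of_mul_eq_mul_of_injective (hrotate ω' k) (exchange_injective hrot)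
    (hswap ω ω' hstab) hmul

end Orbits

/-- The number of orbits whose chosen representative has stabiliser `K`. When all stabilisers are
normal, the choice of representatives is immaterial. -/
noncomputable def orbitCount (G X : Type*) [Group G] [MulAction G X] (K : Subgroup G) : ℕ :=
  Nat.card {ω : orbitRel.Quotient G X // stabilizer G ω.out = K}

/-- The pairs of stabilisers of `x` and `y` such that the orbit of `x` can be collapsed onto a
different orbit, that of `y`. -/
def collapsiblePairs (G X : Type*) [Group G] [MulAction G X] : Set (Subgroup G × Subgroup G) :=
  {p | p.1 ≤ p.2 ∧ ∃ x y : X, stabilizer G x = p.1 ∧ stabilizer G y = p.2 ∧ y ∉ orbit G x}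

section Generators

variable {G X : Type*} [Group G] [MulAction G X]

theorem stabilizer_mk_out (hnormal : ∀ x : X, (stabilizer G x).Normal) (x : X) :
    stabilizer G (⟦x⟧ : orbitRel.Quotient G X).out = stabilizer G x := by
  obtain ⟨g, hg⟩ := exists_smul_out_eq (G := G) x
  conv_rhs => rw [← hg, stabilizer_smul_of_normal (hnormal _)]

theorem mem_orbit_of_orbitCount_eq_one (hnormal : ∀ x : X, (stabilizer G x).Normal)
    {K : Subgroup G} (hK : orbitCount G X K = 1) {x y : X} (hx : stabilizer G x = K)
    (hy : stabilizer G y = K) : y ∈ orbit G x := by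
  have hsub := (Nat.card_eq_one_iff_unique.mp hK).1
  have hclass := hsub.elim ⟨⟦x⟧, (stabilizer_mk_out hnormal x).trans hx⟩
    ⟨⟦y⟧, (stabilizer_mk_out hnormal y).trans hy⟩
  exact orbitRel_apply.mp (Quotient.exact (congrArg Subtype.val hclass.symm))

variable [Fintype (Subgroup G)]

theorem ncard_collapsiblePairs_le (hnormal : ∀ x : X, (stabilizer G x).Normal) :
    ((collapsiblePairs G X).ncard : ℤ) ≤
      {p : Subgroup G × Subgroup G | p.1 ≤ p.2}.ncard -
        ∑ K : Subgroup G, delta (orbitCount G X K) 1 := by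
  classical
  set E := {p : Subgroup G × Subgroup G | p.1 ≤ p.2}
  let D : Finset (Subgroup G × Subgroup G) := ({K | orbitCount G X K = 1} : Finset _).image
    fun K => (K, K)
  have hDE : (D : Set (Subgroup G × Subgroup G)) ⊆ E := fun p hp => by
    obtain ⟨K, -, rfl⟩ := Finset.mem_image.mp hp
    exact le_refl K
  have hD : (D.card : ℤ) = ∑ K : Subgroup G, delta (orbitCount G X K) 1 := by
    rw [Finset.card_image_of_injective _ fun K K' h => congrArg Prod.fst h, Finset.card_filter]
    simp only [delta, Nat.cast_sum, Nat.cast_ite, Nat.cast_one, Nat.cast_zero]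
  have hdiff := Set.ncard_sdiff_add_ncard_of_subset hDE
  rw [Set.ncard_coe_finset] at hdiff
  suffices h : collapsiblePairs G X ⊆ E \ D by
    have := Set.ncard_le_ncard h
    lia
  rintro p ⟨hle, x, y, hx, hy, hxy⟩
  refine ⟨hle, fun hp => hxy ?_⟩
  obtain ⟨K, hK, rfl⟩ := Finset.mem_image.mp hp
  exact mem_orbit_of_orbitCount_eq_one hnormal (Finset.mem_filter.mp hK).2 hx hy

variable [Finite X]

open Classical in
theorem exists_finset_exchange_smul_right_mem (hnormal : ∀ x : X, (stabilizer G x).Normal)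
    {S : Finset G} (hS : Submonoid.closure (S : Set G) = ⊤) :
    ∃ T : Finset (Function.End X), (T : Set (Function.End X)) ⊆ equivariantEnd G X ∧
      (∀ (ω : orbitRel.Quotient G X) (g : G),
        exchange G ω.out (g • ω.out) ∈ Submonoid.closure (T : Set (Function.End X))) ∧
      T.card ≤ ∑ K ∈ Finset.univ.erase ⊤, S.card * orbitCount G X K := by
  have := Fintype.ofFinite (orbitRel.Quotient G X)
  let rotations (K : Subgroup G) : Finset (Function.End X) :=
    (S ×ˢ ({ω | stabilizer G ω.out = K} : Finset (orbitRel.Quotient G X))).image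
      fun p => exchange G p.2.out (p.1 • p.2.out)
  refine ⟨(Finset.univ.erase ⊤).biUnion rotations, ?_, fun ω g => ?_, ?_⟩
  · intro τ hτ
    obtain ⟨K, -, hK⟩ := Finset.mem_biUnion.mp hτ
    obtain ⟨p, -, rfl⟩ := Finset.mem_image.mp hK
    exact exchange_mem (stabilizer_smul_of_normal (hnormal _) _).symm
  · refine exchange_smul_right_mem_of_closure_eq_top hS (hnormal _) (fun s hs => ?_) g
    by_cases htop : stabilizer G ω.out = ⊤
    · have hfix : s • ω.out = ω.out := mem_stabilizer_iff.mp (htop ▸ Subgroup.mem_top s)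
      rw [hfix, exchange_self_right]
      exact one_mem _
    · refine Submonoid.subset_closure (Finset.mem_biUnion.mpr
        ⟨_, Finset.mem_erase.mpr ⟨htop, Finset.mem_univ _⟩, ?_⟩)
      exact Finset.mem_image.mpr ⟨(s, ω), by simpa using hs, rfl⟩
  · refine Finset.card_biUnion_le.trans (Finset.sum_le_sum fun K _ => Finset.card_image_le.trans ?_)
    rw [Finset.card_product, orbitCount, Nat.card_eq_fintype_card, Fintype.card_subtype]

open Classical in
theorem exists_finset_exchange_out_mem :
    ∃ T : Finset (Function.End X), (T : Set (Function.End X)) ⊆ equivariantEnd G X ∧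
      (∀ ω ω' : orbitRel.Quotient G X, stabilizer G ω.out = stabilizer G ω'.out →
        exchange G ω.out ω'.out ∈ Submonoid.closure (T : Set (Function.End X))) ∧
      (T.card : ℤ) ≤ ∑ K : Subgroup G,
        (2 - delta (orbitCount G X K) 2 - 2 * delta (orbitCount G X K) 1) := by
  choose P hP hcard using fun K : Subgroup G =>
    exists_closure_perm_eq_top {ω : orbitRel.Quotient G X // stabilizer G ω.out = K}
  refine ⟨Finset.univ.biUnion fun K => (P K).image (permuteOrbits K), ?_, fun ω ω' h => ?_, ?_⟩
  · intro τ hτ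
    obtain ⟨K, -, hK⟩ := Finset.mem_biUnion.mp hτ
    obtain ⟨σ, -, rfl⟩ := Finset.mem_image.mp hK
    exact permuteOrbits_mem σ
  · refine exchange_out_mem_of_closure_perm_eq_top (hP _) (fun σ hσ => ?_) ⟨ω, h⟩ ⟨ω', rfl⟩
    exact Submonoid.subset_closure (Finset.mem_biUnion.mpr
      ⟨_, Finset.mem_univ _, Finset.mem_image_of_mem _ hσ⟩)
  · refine le_trans ?_ (Finset.sum_le_sum fun K _ => hcard K)
    exact_mod_cast Finset.card_biUnion_le.trans (Finset.sum_le_sum fun K _ => Finset.card_image_le)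

theorem exists_finset_collapse_mem (hnormal : ∀ x : X, (stabilizer G x).Normal) :
    ∃ T : Finset (Function.End X), (T : Set (Function.End X)) ⊆ equivariantEnd G X ∧
      (∀ N : Submonoid (Function.End X), (T : Set (Function.End X)) ⊆ N →
        (∀ x y, stabilizer G x = stabilizer G y → exchange G x y ∈ N) →
        ∀ x y, stabilizer G x ≤ stabilizer G y → y ∉ orbit G x → collapse G x y ∈ N) ∧
      (T.card : ℤ) ≤ {p : Subgroup G × Subgroup G | p.1 ≤ p.2}.ncard -
        ∑ K : Subgroup G, delta (orbitCount G X K) 1 := by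
  classical
  have := Fintype.ofFinite (collapsiblePairs G X)
  choose a b ha hb hab using fun p : collapsiblePairs G X => p.2.2
  have hle : ∀ p, stabilizer G (a p) ≤ stabilizer G (b p) := fun p => by
    rw [ha, hb]
    exact p.2.1
  refine ⟨Finset.univ.image fun p => collapse G (a p) (b p), ?_, ?_, ?_⟩
  · intro τ hτ
    obtain ⟨p, -, rfl⟩ := Finset.mem_image.mp hτ
    exact collapse_mem (hle p)
  · intro N hT hexchange x y hxy hyx
    let p : collapsiblePairs G X := ⟨(stabilizer G x, stabilizer G y), hxy, x, y, rfl, rfl, hyx⟩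
    exact collapse_mem_of_stabilizer_eq hexchange (ha p) (hb p) (hab p) hyx (hle p)
      (hT (Finset.mem_image_of_mem _ (Finset.mem_univ p)))
  · refine le_trans ?_ (ncard_collapsiblePairs_le hnormal)
    rw [← Nat.card_coe_set_eq, Nat.card_eq_fintype_card]
    exact_mod_cast Finset.card_image_le

open Classical in
theorem exists_finset_closure_eq (hnormal : ∀ x : X, (stabilizer G x).Normal)
    {S : Finset G} (hS : Submonoid.closure (S : Set G) = ⊤) :
    ∃ T : Finset (Function.End X),
      Submonoid.closure (T : Set (Function.End X)) = equivariantEnd G X ∧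
      (T.card : ℤ) ≤ (∑ K ∈ Finset.univ.erase (⊤ : Subgroup G), S.card * orbitCount G X K) +
        ∑ K : Subgroup G, (2 - 3 * delta (orbitCount G X K) 1 - delta (orbitCount G X K) 2) +
        {p : Subgroup G × Subgroup G | p.1 ≤ p.2}.ncard := by
  obtain ⟨T₁, hT₁, hrotate, hcard₁⟩ := exists_finset_exchange_smul_right_mem hnormal hS
  obtain ⟨T₂, hT₂, hswap, hcard₂⟩ := exists_finset_exchange_out_mem (G := G) (X := X)
  obtain ⟨T₃, hT₃, hcollapse, hcard₃⟩ := exists_finset_collapse_mem hnormal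
  refine ⟨T₁ ∪ T₂ ∪ T₃, le_antisymm (Submonoid.closure_le.mpr ?_) ?_, ?_⟩
  · simp only [Finset.coe_union, Set.union_subset_iff]
    exact ⟨⟨hT₁, hT₂⟩, hT₃⟩
  · set N := Submonoid.closure (↑(T₁ ∪ T₂ ∪ T₃) : Set (Function.End X))
    have hN : (↑(T₁ ∪ T₂ ∪ T₃) : Set (Function.End X)) ⊆ N := Submonoid.subset_closure
    simp only [Finset.coe_union, Set.union_subset_iff] at hN
    have hexchange : ∀ x y, stabilizer G x = stabilizer G y → exchange G x y ∈ N := fun x y =>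
      exchange_mem_of_exchange_out_mem hnormal
        (fun ω g => Submonoid.closure_le.mpr hN.1.1 (hrotate ω g))
        (fun ω ω' h => Submonoid.closure_le.mpr hN.1.2 (hswap ω ω' h))
    exact equivariantEnd_le_of_exchange_mem_of_collapse_mem hexchange
      (hcollapse N hN.2 hexchange)
  · have hcard := (Finset.card_union_le (T₁ ∪ T₂) T₃).trans
      (Nat.add_le_add_right (Finset.card_union_le T₁ T₂) _)
    zify at hcard hcard₁ ⊢
    simp only [Finset.sum_sub_distrib, ← Finset.mul_sum] at hcard₂ ⊢
    simp only [← Finset.mul_sum] at hcard₁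
    linarith

end Generators

end equivariantEnd

namespace FiniteCA

variable {G A : Type*} [Group G]

theorem rank_le_card {M : Type*} [Monoid M] {S : Submonoid M} {T : Finset M}
    (h : Submonoid.closure (T : Set M) = S) : rank S ≤ T.card := by
  classical
  subst h
  have hinj := Subtype.val_injective (p := (· ∈ Submonoid.closure (T : Set M)))
  let T' : Finset (Submonoid.closure (T : Set M)) := T.preimage Subtype.val hinj.injOn
  have hT' : Submonoid.closure (T' : Set (Submonoid.closure (T : Set M))) = ⊤ := by
    rw [Finset.coe_preimage]
    exact Submonoid.closure_closure_coe_preimage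
  calc rank (Submonoid.closure (T : Set M)) ≤ T'.card := Nat.sInf_le ⟨T', rfl, hT'⟩
    _ ≤ T.card := Finset.card_le_card_of_injOn Subtype.val
      (fun x hx => Finset.mem_preimage.mp hx) hinj.injOn

/-- The left action `g • x = x · g⁻¹` associated with the right action of `G` on configurations. -/
@[reducible]
def shiftAction (G A : Type*) [Group G] : MulAction G (G → A) where
  smul g x := shift x g⁻¹
  one_smul x := by
    change shift x 1⁻¹ = x
    rw [inv_one, shift_one]
  mul_smul g k x := by
    change shift x (g * k)⁻¹ = shift (shift x k⁻¹) g⁻¹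
    rw [mul_inv_rev, shift_mul]

attribute [local instance] shiftAction

theorem smul_apply (g : G) (x : G → A) (k : G) : (g • x) k = x (k * g) :=
  congrArg (fun g => x (k * g)) (inv_inv g)

theorem stabilizer_eq_stabiliser (x : G → A) : stabilizer G x = stabiliser x := by
  ext g
  exact inv_mem_iff (H := stabiliser x)

theorem orbit_eq_mulActionOrbit (x : G → A) : orbit x = MulAction.orbit G x :=
  (inv_surjective.range_comp (shift x)).symm

theorem CA_eq_equivariantEnd [Finite G] : CA G A = equivariantEnd G (G → A) := by
  have := Fintype.ofFinite G
  ext τ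
  constructor
  · rintro ⟨S, μ, hμ⟩ g x
    funext k
    simp only [smul_apply, hμ, mul_assoc]
  · intro hτ
    refine ⟨Finset.univ, fun y => τ (fun k => y ⟨k, Finset.mem_univ k⟩) 1, fun x g => ?_⟩
    calc τ x g = (g • τ x) 1 := by rw [smul_apply, one_mul]
      _ = τ (g • x) 1 := by rw [hτ]
      _ = τ (fun k => x (k * g)) 1 := by rw [funext (smul_apply g x)]

theorem conjugate_eq_self {H : Subgroup G} (hH : H.Normal) (g : G) : conjugate H g = H :=
  hH.conj_smul_eq_self g⁻¹

theorem conjClass_eq_singleton {H : Subgroup G} (hH : H.Normal) : conjClass H = {H} := by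
  rw [conjClass, funext (conjugate_eq_self hH), Set.range_const]

theorem alpha_eq_orbitCount (hG : ∀ K : Subgroup G, K.Normal) (K : Subgroup G) :
    alpha A (conjClass K) = equivariantEnd.orbitCount G (G → A) K := by
  have himage : {O ∈ orbits G A | O ⊆ block A (conjClass K)} =
      orbitRel.Quotient.orbit '' {ω : orbitRel.Quotient G (G → A) | stabilizer G ω.out = K} := by
    ext O
    simp only [block, conjClass_eq_singleton (hG K), ← stabilizer_eq_stabiliser]
    constructor
    · rintro ⟨⟨x, rfl⟩, hx⟩
      refine ⟨⟦x⟧, ?_, (orbit_eq_mulActionOrbit x).symm⟩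
      exact (equivariantEnd.stabilizer_mk_out (fun _ => hG _) x).trans (hx ⟨1, shift_one x⟩)
    · rintro ⟨ω, hω, rfl⟩
      rw [orbitRel.Quotient.orbit_eq_orbit_out ω Quotient.out_eq']
      refine ⟨⟨ω.out, orbit_eq_mulActionOrbit _⟩, ?_⟩
      rintro _ ⟨g, rfl⟩
      exact (equivariantEnd.stabilizer_smul_of_normal (hG _) g).trans hω
  rw [alpha, himage, Set.ncard_image_of_injective _ orbitRel.Quotient.orbit_injective]
  rfl

theorem alpha_top : alpha A (conjClass (⊤ : Subgroup G)) = Nat.card A := by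
  have horbit (a : A) : orbit (fun _ : G => a) = {fun _ => a} := Set.range_const
  have hrange : {O ∈ orbits G A | O ⊆ block A (conjClass (⊤ : Subgroup G))} =
      Set.range fun a : A => ({fun _ => a} : Set (G → A)) := by
    ext O
    rw [conjClass_eq_singleton inferInstance]
    constructor
    · rintro ⟨⟨x, rfl⟩, hO⟩
      have hx : stabilizer G x = ⊤ := by
        rw [stabilizer_eq_stabiliser]
        exact hO ⟨1, shift_one x⟩
      have hconst : x = fun _ => x 1 := funext fun g => by
        have hg : g • x = x := mem_stabilizer_iff.mp (hx ▸ Subgroup.mem_top g)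
        calc x g = (g • x) 1 := by rw [smul_apply, one_mul]
          _ = x 1 := by rw [hg]
      exact ⟨x 1, by rw [hconst, horbit]⟩
    · rintro ⟨a, rfl⟩
      refine ⟨⟨fun _ => a, horbit a⟩, ?_⟩
      rintro _ rfl
      exact (Subgroup.eq_top_iff' _).mpr fun g => rfl
  have hinj : Function.Injective fun a : A => ({fun _ => a} : Set (G → A)) := fun a b hab =>
    congrFun (Set.singleton_injective hab) 1
  rw [alpha, hrange, ← Set.image_univ, Set.ncard_image_of_injective _ hinj, Set.ncard_univ]

theorem edges_eq_image : edges G = Prod.map conjClass conjClass ''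
    {p : Subgroup G × Subgroup G | ∃ g, p.1 ≤ conjugate p.2 g} := by
  ext p
  constructor
  · rintro ⟨H, K, rfl, h⟩
    exact ⟨(H, K), h, rfl⟩
  · rintro ⟨⟨H, K⟩, h, rfl⟩
    exact ⟨H, K, rfl, h⟩

theorem ncard_edges (hG : ∀ K : Subgroup G, K.Normal) :
    (edges G).ncard = {p : Subgroup G × Subgroup G | p.1 ≤ p.2}.ncard := by
  have hinj : Function.Injective (conjClass (G := G)) := fun H K h => by
    rwa [conjClass_eq_singleton (hG H), conjClass_eq_singleton (hG K),
      Set.singleton_eq_singleton_iff] at h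
  simp only [edges_eq_image, Set.ncard_image_of_injective _ (hinj.prodMap hinj),
    conjugate_eq_self (hG _), exists_const]

theorem ncard_edges_le [Finite G] : (edges G).ncard ≤ Nat.card (Subgroup G) ^ 2 := by
  rw [edges_eq_image, sq, ← Nat.card_prod, ← Set.ncard_univ]
  exact (Set.ncard_image_le (Set.toFinite _)).trans (Set.ncard_le_ncard (Set.subset_univ _))

theorem delta_nonneg (a b : ℕ) : 0 ≤ delta a b := by
  unfold delta
  split_ifs <;> norm_num

open Classical in
theorem rank_CA_le [Finite G] [Finite A] [Fintype (Subgroup G)]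
    (hG : ∀ K : Subgroup G, K.Normal) :
    (rank (CA G A) : ℤ) ≤
      (∑ K ∈ Finset.univ.erase (⊤ : Subgroup G), (rank G * alpha A (conjClass K) + 2 -
        3 * delta (alpha A (conjClass K)) 1 - delta (alpha A (conjClass K)) 2)) +
      (2 - delta (Nat.card A) 2) + (edges G).ncard := by
  obtain ⟨S, hScard, hS⟩ := exists_card_eq_rank G
  obtain ⟨T, hT, hTcard⟩ :=
    equivariantEnd.exists_finset_closure_eq (X := G → A) (fun _ => hG _) hS
  simp only [← alpha_eq_orbitCount hG, ← ncard_edges hG, hScard] at hTcard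
  rw [← Finset.add_sum_erase _ _ (Finset.mem_univ ⊤), alpha_top] at hTcard
  have hrank : rank (CA G A) ≤ T.card := rank_le_card (hT.trans CA_eq_equivariantEnd.symm)
  have hdelta := delta_nonneg (Nat.card A) 1
  push_cast at hTcard
  simp only [Finset.sum_sub_distrib, Finset.sum_add_distrib] at hTcard ⊢
  lia

end FiniteCA

theorem card_eq_of_bijOn_Icc {S : Type*} {r : ℕ} {H : ℕ → S}
    (hH : Set.BijOn H (Set.Icc 1 r) Set.univ) : Nat.card S = r := by
  rw [← Set.ncard_univ, ← hH.image_eq, hH.injOn.ncard_image, ← Finset.coe_Icc,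
    Set.ncard_coe_finset, Nat.card_Icc, Nat.add_sub_cancel]

theorem sum_Icc_two_eq_sum_erase {S M : Type*} [Fintype S] [DecidableEq S] [AddCommMonoid M]
    {r : ℕ} {H : ℕ → S} (hH : Set.BijOn H (Set.Icc 1 r) Set.univ) (f : S → M) :
    ∑ i ∈ Finset.Icc 2 r, f (H i) = ∑ K ∈ Finset.univ.erase (H 1), f K := by
  refine Finset.sum_nbij H (fun i hi => ?_) ?_ (fun K hK => ?_) fun _ _ => rfl
  · have hi := Finset.mem_Icc.mp hi
    refine Finset.mem_erase.mpr ⟨fun h => ?_, Finset.mem_univ _⟩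
    have := hH.injOn ⟨by lia, hi.2⟩ ⟨le_rfl, by lia⟩ h
    lia
  · rw [Finset.coe_Icc]
    exact hH.injOn.mono (Set.Icc_subset_Icc_left one_le_two)
  · obtain ⟨i, hi, rfl⟩ := hH.surjOn (Set.mem_univ K)
    have hi1 : i ≠ 1 := fun h => (Finset.mem_erase.mp hK).1 (h ▸ rfl)
    exact ⟨i, Finset.mem_coe.mpr (Finset.mem_Icc.mpr ⟨by have := hi.1; lia, hi.2⟩), rfl⟩

theorem mainTheorem5_general {G A : Type*} [Group G] [Finite G] [Finite A]
    (hG : ∀ K : Subgroup G, K.Normal) (m q r : ℕ) (hm : FiniteCA.rank G = m) (hq : Nat.card A = q)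
    (H : ℕ → Subgroup G) (hH : Set.BijOn H (Set.Icc 1 r) Set.univ) (hH1 : H 1 = ⊤)
    (α : ℕ → ℕ) (hα : ∀ i ∈ Set.Icc 1 r, α i = FiniteCA.alpha A (FiniteCA.conjClass (H i))) :
    (FiniteCA.rank (FiniteCA.CA G A) : ℤ) ≤
        (∑ i ∈ Finset.Icc 2 r, (m : ℤ) * α i) + 2 * r + (FiniteCA.edges G).ncard
          - FiniteCA.delta q 2
          - ∑ i ∈ Finset.Icc 2 r, (3 * FiniteCA.delta (α i) 1 + FiniteCA.delta (α i) 2) ∧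
      (∑ i ∈ Finset.Icc 2 r, (m : ℤ) * α i) + 2 * r + (FiniteCA.edges G).ncard
          - FiniteCA.delta q 2
          - ∑ i ∈ Finset.Icc 2 r, (3 * FiniteCA.delta (α i) 1 + FiniteCA.delta (α i) 2) ≤
        (∑ i ∈ Finset.Icc 2 r, (m : ℤ) * α i) + 2 * r + (r : ℤ) ^ 2 := by
  classical
  have := Fintype.ofFinite (Subgroup G)
  have hr : Nat.card (Subgroup G) = r := card_eq_of_bijOn_Icc hH
  have hαH : ∀ i ∈ Finset.Icc 2 r, FiniteCA.alpha A (FiniteCA.conjClass (H i)) = α i :=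
    fun i hi => by
      have hi := Finset.mem_Icc.mp hi
      exact (hα i ⟨by lia, hi.2⟩).symm
  constructor
  · have hrank := FiniteCA.rank_CA_le (A := A) hG
    rw [← hH1, ← sum_Icc_two_eq_sum_erase hH, hm, hq,
      Finset.sum_congr rfl fun i hi => by rw [hαH i hi]] at hrank
    have hr0 : 0 < r := hr ▸ Nat.card_pos
    simp only [Finset.sum_sub_distrib, Finset.sum_add_distrib, Finset.sum_const, Nat.card_Icc,
      nsmul_eq_mul] at hrank ⊢
    lia
  · have hedges : ((FiniteCA.edges G).ncard : ℤ) ≤ (r : ℤ) ^ 2 := by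
      exact_mod_cast hr ▸ FiniteCA.ncard_edges_le (G := G)
    have hq := FiniteCA.delta_nonneg q 2
    have hsum : 0 ≤ ∑ i ∈ Finset.Icc 2 r,
        (3 * FiniteCA.delta (α i) 1 + FiniteCA.delta (α i) 2) :=
      Finset.sum_nonneg fun i _ => by
        have := FiniteCA.delta_nonneg (α i) 1
        have := FiniteCA.delta_nonneg (α i) 2
        lia
    lia

theorem mainTheorem5 {G A : Type*} [CommGroup G] [Finite G] [Finite A]
    (m q r : ℕ) (hm : FiniteCA.rank G = m) (hq : Nat.card A = q) (hq2 : 2 ≤ q)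
    (H : ℕ → Subgroup G) (hH : Set.BijOn H (Set.Icc 1 r) Set.univ) (hH1 : H 1 = ⊤)
    (α : ℕ → ℕ) (hα : ∀ i ∈ Set.Icc 1 r, α i = FiniteCA.alpha A (FiniteCA.conjClass (H i))) :
    (FiniteCA.rank (FiniteCA.CA G A) : ℤ) ≤
        (∑ i ∈ Finset.Icc 2 r, (m : ℤ) * α i) + 2 * r + (FiniteCA.edges G).ncard
          - FiniteCA.delta q 2
          - ∑ i ∈ Finset.Icc 2 r, (3 * FiniteCA.delta (α i) 1 + FiniteCA.delta (α i) 2) ∧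
      (∑ i ∈ Finset.Icc 2 r, (m : ℤ) * α i) + 2 * r + (FiniteCA.edges G).ncard
          - FiniteCA.delta q 2
          - ∑ i ∈ Finset.Icc 2 r, (3 * FiniteCA.delta (α i) 1 + FiniteCA.delta (α i) 2) ≤
        (∑ i ∈ Finset.Icc 2 r, (m : ℤ) * α i) + 2 * r + (r : ℤ) ^ 2 :=
  mainTheorem5_general (fun _ => inferInstance) m q r hm hq H hH hH1 α hα
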